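/- Consider the synchronous, randomized $\mathsf{CONGEST}$ model on an undirected simple graph $G=(V,E)$ with $n\ge 2$ vertices (not necessarily connected). Each vertex is a processor with a unique, arbitrary identifier of $O(\log n)$ bits and a private string of random bits. It knows $n$, its own identifier and its degree, and it refers to its incident edges by arbitrary port numbers. In each round it may send one message of $O(\log n)$ bits to each of its neighbors, and local computation is free. All logarithms are to base $2$. For an integer $t\ge 1$ and $v\in V$ let $\Gamma_t(v)=\{w\in V : \mathrm{dist}_G(v,w)\le t\}$. A $t$-neighborhood cover with strong diameter at most $d$ and overlap at most $q$ is a family of clusters $S_1,S_2,\ldots\subseteq V$ such that (i) for every $v\in V$ there is an $i$ with $\Gamma_t(v)\subseteq S_i$; (ii) each induced subgraph $G[S_i]$ is connected and has diameter at most $d$; (iii) each vertex belongs to at most $q$ clusters. **Lemma.** Let $k=2\log n$. For every $a\in\mathbb N$ there are $b,e\in\mathbb N$ such that for every $c\in\mathbb N$ there are a constant $C$ and, for all integers $n\ge2$ and $t\ge 1$, a randomized $\mathsf{CONGEST}$ algorithm with messages of at most $b\log n$ bits, such that the following holds on every $n$-vertex graph $G$ with arbitrary distinct identifiers in $\{0,\dots,n^a-1\}$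 and arbitrary port numberings: 1. the algorithm runs for at most $C\cdot k\,t\log n$ rounds; 2. in every execution, at most $C(\log n)^{e}$, that is $\widetilde O(1)$, messages are sent in total through each edge of $G$; 3. with probability at least $1-n^{-c}$, the clusters that it constructs (each vertex outputs the names of the clusters that contain it) form a $t$-neighborhood cover of $G$ with overlap at most $q=C\log n$ in which every cluster has strong diameter at most $C\cdot t\,k\log n$. -/

import Mathlib

universe u

/-- A randomized algorithm for the synchronous CONGEST model. Every node runs the same code, knows
initially only its own identifier, its degree and its private string of `coins` fair random bits,
and refers to its incident edges by port numbers `0, …, degree - 1`. In each of the `rounds` rounds,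
it sends through each of its ports at most one message of `bandwidth` bits (`none` means that
nothing is sent), receives the messages that its neighbors sent to it in the same round, and updates
its state by an arbitrary local computation. After the last round it outputs a finite set of labels:
the names of the clusters it belongs to. -/
structure CongestAlgorithm where
  State : Type
  rounds : ℕ
  bandwidth : ℕ
  coins : ℕ
  init : (ident : ℕ) → (degree : ℕ) → (Fin coins → Bool) → State
  send : State → (port : ℕ) → Option (BitVec bandwidth)
  receive : State → {degree : ℕ} → (inbox : Fin degree → Option (BitVec bandwidth)) → State
  output : State → Finset ℕ

/-- The data that turn a graph into a network: arbitrary distinct identifiers of the nodes, and at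
each node an arbitrary numbering of its incident edges by ports. -/
structure Network {V : Type u} [Fintype V] (G : SimpleGraph V) [DecidableRel G.Adj] where
  ident : V → ℕ
  ident_injective : Function.Injective ident
  port : (v : V) → G.neighborSet v ≃ Fin (G.degree v)

namespace CongestAlgorithm

variable {V : Type u} [Fintype V] {G : SimpleGraph V} [DecidableRel G.Adj]

/-- The message, if any, that `v` sends to its neighbor `w` when the states of the nodes are `σ`. -/
def message (A : CongestAlgorithm) (N : Network G) (σ : V → A.State) (v w : V) (h : G.Adj v w) :
    Option (BitVec A.bandwidth) :=
  A.send (σ v) (N.port v ⟨w, h⟩)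

/-- The state of each node after `r` rounds, where `ω v` is the private random string of `v`. -/
def stateAfter (A : CongestAlgorithm) (N : Network G) (ω : V → Fin A.coins → Bool) :
    ℕ → V → A.State
  | 0 => fun v => A.init (N.ident v) (G.degree v) (ω v)
  | r + 1 => fun v =>
      A.receive (A.stateAfter N ω r v) fun p : Fin (G.degree v) =>
        A.message N (A.stateAfter N ω r) ((N.port v).symm p) v
          (((N.port v).symm p).property : G.Adj v _).symm

/-- The number of messages sent through the edge `vw`, in both directions, in the entire
execution. -/
def messagesOnEdge (A : CongestAlgorithm) (N : Network G) (ω : V → Fin A.coins → Bool)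
    (v w : V) (h : G.Adj v w) : ℕ :=
  ∑ r ∈ Finset.range A.rounds,
    ((A.message N (A.stateAfter N ω r) v w h).isSome.toNat +
      (A.message N (A.stateAfter N ω r) w v h.symm).isSome.toNat)

/-- The cluster named `l`: all nodes that have `l` in their output. -/
def cluster (A : CongestAlgorithm) (N : Network G) (ω : V → Fin A.coins → Bool) (l : ℕ) : Set V :=
  {v | l ∈ A.output (A.stateAfter N ω A.rounds v)}

end CongestAlgorithm

/-- The family of clusters `S` is a `t`-neighborhood cover of `G` with strong diameter at most `d`
and overlap at most `q`: the `t`-ball around each vertex lies in some cluster, each cluster induces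
a subgraph of `G` of (finite) diameter at most `d`, and each vertex is in at most `q` clusters. -/
structure IsNeighborhoodCover {V : Type u} {ι : Type*} (G : SimpleGraph V) (t : ℕ) (d q : ℝ)
    (S : ι → Set V) : Prop where
  ball_subset : ∀ v, ∃ i, {w | G.edist v w ≤ t} ⊆ S i
  diam_le : ∀ i, (G.induce (S i)).ediam ≠ ⊤ ∧ ((G.induce (S i)).diam : ℝ) ≤ d
  overlap_le : ∀ v, {i | v ∈ S i}.Finite ∧ (({i | v ∈ S i}.ncard : ℕ) : ℝ) ≤ q

/-! The algorithm repeats a random partition `O(log n)` times. In each phase every vertex draws a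
geometric number of leading heads, truncated at `m`, and starts a wave earlier by `L = 2t + 1`
rounds per head; each vertex joins the first wave that reaches it. If the wave of `u` would reach
`v` more than `2t` rounds before all others, no vertex of the `t`-ball around `v` can be captured by
another wave, so the ball lies in one cluster. A gap this large is a consequence of memorylessness.
With the coins of all others fixed, `u` is unbeaten at `v` if and only if its heads reach a
threshold independent of its own coins. Given that, one further head, worth `L > 2t` rounds, comes
with probability 1/2, apart from truncation. Some vertex is always unbeaten, and truncation costs at
most `n * 2 ^ (-m) ≤ 1/2`, so `1 ≤ 2 * P(leader) + 1/2` and a leader exists with probability at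
least 1/4 (`card_not_exists_leads_le`). Phases use disjoint coins, so the failure probabilities
multiply, and a union bound over the vertices finishes. Overlap and messages per edge are
proportional to the number of phases, the diameter to the length of one phase. -/

/-- The number of heads before the first tail in a sequence of `m` coin flips. -/
def leadingHeads {m : ℕ} (x : Fin m → Bool) : ℕ :=
  Nat.findGreatest (fun j => ∀ i : Fin m, i.val < j → x i = true) m

theorem leadingHeads_le {m : ℕ} (x : Fin m → Bool) : leadingHeads x ≤ m :=
  Nat.findGreatest_le m

theorem le_leadingHeads_iff {m j : ℕ} (x : Fin m → Bool) (hj : j ≤ m) :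
    j ≤ leadingHeads x ↔ ∀ i : Fin m, i.val < j → x i = true := by
  constructor
  · intro h i hi
    have := Nat.findGreatest_spec (P := fun j => ∀ i : Fin m, i.val < j → x i = true)
      (Nat.zero_le m) (by simp)
    exact this i (lt_of_lt_of_le hi h)
  · intro h
    exact Nat.le_findGreatest hj h

/-! ### Geometric head starts and the gap behind the leader -/

section Gap

variable {V : Type u} {m : ℕ}

/-- When the vertex `u` has the head start `L * leadingHeads (ω u)` over a distance `d u`, it beats
every competitor in `S` by more than `g`. -/
def Leads (S : Finset V) (d : V → ℕ) (L g : ℕ) (ω : V → Fin m → Bool) (u : V) : Prop :=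
  ∀ w ∈ S, w ≠ u → L * leadingHeads (ω w) + d u + g < L * leadingHeads (ω u) + d w

/-- Replacing the constant coins of `u` by arbitrary ones is injective. This bounds the loss from
truncation. -/
theorem card_coins_eq_mul_pow_le [Finite V] (u : V) :
    Nat.card {ω : V → Fin m → Bool // ω u = fun _ => true} * 2 ^ m ≤
      Nat.card (V → Fin m → Bool) := by
  classical
  have h : (2 : ℕ) ^ m = Nat.card (Fin m → Bool) := by simp
  rw [h, ← Nat.card_prod]
  refine Nat.card_le_card_of_injective
    (fun z => Function.update z.1.1 u z.2) ?_
  rintro ⟨⟨ω, h1⟩, x⟩ ⟨⟨ω', h2⟩, x'⟩ h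
  simp only at h
  have hx : x = x' := by simpa using congrFun h u
  subst hx
  have : ω = ω' := by
    funext v
    by_cases hv : v = u
    · subst hv; rw [h1, h2]
    · simpa [hv] using congrFun h v
  subst this
  rfl

/-- The least number of heads with which `u` is not beaten by its competitors in `S`. -/
noncomputable def headsNeeded (S : Finset V) (d : V → ℕ) (L : ℕ) (u : V)
    (ω : V → Fin m → Bool) : ℕ :=
  sInf {j | ∀ w ∈ S, w ≠ u → L * leadingHeads (ω w) + d u ≤ L * j + d w}

theorem headsNeeded_spec (S : Finset V) (d : V → ℕ) {L : ℕ} (hL : 0 < L) (u : V)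
    (ω : V → Fin m → Bool) : ∀ w ∈ S, w ≠ u →
      L * leadingHeads (ω w) + d u ≤ L * headsNeeded S d L u ω + d w := by
  have hne : {j | ∀ w ∈ S, w ≠ u → L * leadingHeads (ω w) + d u ≤ L * j + d w}.Nonempty := by
    -- No competitor has more than `m` heads, and since `L ≥ 1` another `d u` heads pay for the
    -- distance.
    refine ⟨m + d u, fun w _ _ => ?_⟩
    have h1 := Nat.mul_le_mul_left L (leadingHeads_le (ω w))
    have h2 : d u ≤ L * d u := Nat.le_mul_of_pos_left _ hL
    rw [mul_add]
    omega
  exact Nat.sInf_mem hne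

theorem headsNeeded_le {S : Finset V} {d : V → ℕ} {L : ℕ} {u : V} {ω : V → Fin m → Bool} {j : ℕ}
    (h : ∀ w ∈ S, w ≠ u → L * leadingHeads (ω w) + d u ≤ L * j + d w) :
    headsNeeded S d L u ω ≤ j :=
  Nat.sInf_le h

/-- The threshold involves only competitors `w ≠ u`, so the coins of `u` can be altered with the
threshold held fixed. -/
theorem headsNeeded_update [DecidableEq V] (S : Finset V) (d : V → ℕ) (L : ℕ) (u : V) (ω : V → Fin m → Bool)
    (x : Fin m → Bool) :
    headsNeeded S d L u (Function.update ω u x) = headsNeeded S d L u ω := by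
  unfold headsNeeded
  congr 1
  ext j
  refine forall_congr' fun w => forall_congr' fun _ => forall_congr' fun hw => ?_
  rw [Function.update_of_ne hw]

theorem leads_of_headsNeeded_lt {S : Finset V} {d : V → ℕ} {L g : ℕ} (hg : g < L) {u : V}
    {ω : V → Fin m → Bool} (h : headsNeeded S d L u ω < leadingHeads (ω u)) :
    Leads S d L g ω u := by
  intro w hw hwu
  have h1 := headsNeeded_spec S d (by omega : 0 < L) u ω w hw hwu
  have h2 := Nat.mul_le_mul_left L (Nat.succ_le_of_lt h)
  rw [Nat.succ_eq_add_one, mul_add] at h2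
  omega

/-- Apart from truncation, the leader has a head start with probability at least one half. -/
theorem card_headsNeeded_le [Finite V] (S : Finset V) (d : V → ℕ) {L g : ℕ} (hg : g < L) (u : V) :
    Nat.card {ω : V → Fin m → Bool // headsNeeded S d L u ω ≤ leadingHeads (ω u)} ≤
      2 * Nat.card {ω : V → Fin m → Bool // Leads S d L g ω u} +
        Nat.card {ω : V → Fin m → Bool // ω u = fun _ => true} := by
  classical
  -- On `D` the heads of `u` meet the threshold exactly, and the next flip exists and is a tail.
  let D : Set (V → Fin m → Bool) :=
    {ω | headsNeeded S d L u ω ≤ leadingHeads (ω u) ∧ ¬ Leads S d L g ω u ∧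
      ¬ ω u = fun _ => true}
  have key : ∀ ω ∈ D, ∃ h : headsNeeded S d L u ω < m, ω u ⟨_, h⟩ = false := by
    rintro ω ⟨h1, h2, h3⟩
    have h4 : leadingHeads (ω u) ≤ headsNeeded S d L u ω := by
      by_contra! h
      exact h2 (leads_of_headsNeeded_lt hg h)
    have h5 : headsNeeded S d L u ω < m := by
      by_contra! h
      apply h3
      funext i
      exact (le_leadingHeads_iff (ω u) le_rfl).1 (h.trans h1) i i.2
    refine ⟨h5, ?_⟩
    by_contra h
    have : headsNeeded S d L u ω + 1 ≤ leadingHeads (ω u) := by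
      rw [le_leadingHeads_iff _ (by omega)]
      intro i hi
      rcases Nat.lt_succ_iff_lt_or_eq.1 hi with h' | h'
      · exact (le_leadingHeads_iff _ h5.le).1 h1 i h'
      · have : i = ⟨_, h5⟩ := Fin.ext h'
        rw [this]
        simpa using h
    omega
  -- Turning this tail into a head makes `u` a leader. The threshold is unchanged and locates the
  -- altered flip, so `f` is injective.
  let f : D → (V → Fin m → Bool) := fun ω =>
    Function.update ω.1 u (Function.update (ω.1 u) ⟨_, (key ω.1 ω.2).1⟩ true)
  have hfn : ∀ ω : D, headsNeeded S d L u (f ω) = headsNeeded S d L u ω.1 := fun ω =>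
    headsNeeded_update S d L u ω.1 _
  have hf : ∀ ω : D, Leads S d L g (f ω) u := by
    intro ω
    apply leads_of_headsNeeded_lt hg
    rw [hfn, Nat.lt_iff_add_one_le, le_leadingHeads_iff _ (key ω.1 ω.2).1]
    intro i hi
    simp only [f, Function.update_self]
    by_cases h : i = ⟨_, (key ω.1 ω.2).1⟩
    · rw [h, Function.update_self]
    · rw [Function.update_of_ne h]
      refine (le_leadingHeads_iff _ (key ω.1 ω.2).1.le).1 ω.2.1 i ?_
      have : i.val ≠ headsNeeded S d L u ω.1 := fun h' => h (Fin.ext h')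
      omega
  have hinj : Function.Injective (fun ω : D =>
      (⟨f ω, hf ω⟩ : {ω : V → Fin m → Bool // Leads S d L g ω u})) := by
    intro ω ω' h
    have h : f ω = f ω' := congrArg Subtype.val h
    have hn : headsNeeded S d L u ω.1 = headsNeeded S d L u ω'.1 := by rw [← hfn, ← hfn, h]
    obtain ⟨h1, h1'⟩ := key ω.1 ω.2
    obtain ⟨h2, h2'⟩ := key ω'.1 ω'.2
    apply Subtype.ext
    funext v
    have hv := congrFun h v
    by_cases hvu : v = u
    · subst hvu
      simp only [f, Function.update_self] at hv
      funext i
      have hi := congrFun hv i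
      by_cases h : i = ⟨_, h1⟩
      · have h' : i = ⟨_, h2⟩ := by rw [h]; exact Fin.ext hn
        rw [h, h1', ← h, h', h2']
      · have h' : i ≠ ⟨_, h2⟩ := by
          rintro rfl; exact h (Fin.ext hn.symm)
        rwa [Function.update_of_ne h, Function.update_of_ne h'] at hi
    · simpa [f, hvu] using hv
  have hD : Nat.card D ≤ Nat.card {ω : V → Fin m → Bool // Leads S d L g ω u} :=
    Nat.card_le_card_of_injective _ hinj
  have hsub : {ω : V → Fin m → Bool | headsNeeded S d L u ω ≤ leadingHeads (ω u)} ⊆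
      (D ∪ {ω | Leads S d L g ω u}) ∪ {ω | ω u = fun _ => true} := by
    intro ω hω
    by_cases h1 : Leads S d L g ω u
    · exact Or.inl (Or.inr h1)
    by_cases h2 : ω u = fun _ => true
    · exact Or.inr h2
    exact Or.inl (Or.inl ⟨hω, h1, h2⟩)
  have h1 := Set.ncard_le_ncard hsub (Set.toFinite _)
  have h2 := Set.ncard_union_le (D ∪ {ω | Leads S d L g ω u}) {ω | ω u = fun _ => true}
  have h3 := Set.ncard_union_le D {ω | Leads S d L g ω u}
  simp only [← Nat.card_coe_set_eq] at h1 h2 h3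
  simp only [Set.coe_ofPred] at h1 h2 h3
  omega

/-- A maximizer of `L * heads - distance` is unbeaten; hence these events cover the whole space. -/
theorem exists_headsNeeded_le {S : Finset V} (hS : S.Nonempty) (d : V → ℕ) (L : ℕ)
    (ω : V → Fin m → Bool) : ∃ u ∈ S, headsNeeded S d L u ω ≤ leadingHeads (ω u) := by
  obtain ⟨u, hu, h⟩ := S.exists_max_image
    (fun u => (L * leadingHeads (ω u) : ℤ) - d u) hS
  refine ⟨u, hu, headsNeeded_le fun w hw _ => ?_⟩
  have := h w hw
  zify
  linarith

/-- With probability at least `1 / 4`, some vertex of `S` beats all others by more than `g`. -/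
theorem card_not_exists_leads_le [Fintype V] {S : Finset V} (hS : S.Nonempty) (d : V → ℕ) {L g : ℕ}
    (hg : g < L) (hm : 2 * Fintype.card V ≤ 2 ^ m) :
    4 * Nat.card {ω : V → Fin m → Bool // ¬ ∃ u ∈ S, Leads S d L g ω u} ≤
      3 * Nat.card (V → Fin m → Bool) := by
  classical
  have h1 : Nat.card (V → Fin m → Bool) ≤
      ∑ u ∈ S, Nat.card {ω : V → Fin m → Bool // headsNeeded S d L u ω ≤ leadingHeads (ω u)} := by
    simp only [Nat.card_eq_fintype_card, Fintype.card_subtype]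
    refine le_trans ?_ Finset.card_biUnion_le
    rw [← Finset.card_univ]
    apply Finset.card_le_card
    intro ω _
    obtain ⟨u, hu, h⟩ := exists_headsNeeded_le hS d L ω
    simp only [Finset.mem_biUnion, Finset.mem_filter, Finset.mem_univ, true_and]
    exact ⟨u, hu, h⟩
  -- Two leaders would beat each other, so the events are disjoint.
  have h2 : ∑ u ∈ S, Nat.card {ω : V → Fin m → Bool // Leads S d L g ω u} =
      Nat.card {ω : V → Fin m → Bool // ∃ u ∈ S, Leads S d L g ω u} := by
    simp only [Nat.card_eq_fintype_card, Fintype.card_subtype]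
    rw [← Finset.card_biUnion]
    · congr 1
      ext ω
      simp
    · intro u hu w hw huw
      rw [Function.onFun, Finset.disjoint_left]
      intro ω ha hb
      simp only [Finset.mem_filter, Finset.mem_univ, true_and] at ha hb
      have := ha w hw huw.symm
      have := hb u hu huw
      omega
  have h3 : Nat.card {ω : V → Fin m → Bool // ∃ u ∈ S, Leads S d L g ω u} +
      Nat.card {ω : V → Fin m → Bool // ¬ ∃ u ∈ S, Leads S d L g ω u} = Nat.card (V → Fin m → Bool) := by
    have h := Fintype.card_subtype_compl fun ω : V → Fin m → Bool => ∃ u ∈ S, Leads S d L g ω u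
    have h' := Fintype.card_subtype_le fun ω : V → Fin m → Bool => ∃ u ∈ S, Leads S d L g ω u
    simp only [Nat.card_eq_fintype_card]
    omega
  have h4 : 2 * ∑ u ∈ S, Nat.card {ω : V → Fin m → Bool // ω u = fun _ => true} ≤ Nat.card (V → Fin m → Bool) := by
    have h5 : (∑ u ∈ S, Nat.card {ω : V → Fin m → Bool // ω u = fun _ => true}) * 2 ^ m ≤
        Fintype.card V * Nat.card (V → Fin m → Bool) := by
      rw [Finset.sum_mul]
      calc _ ≤ ∑ u ∈ S, Nat.card (V → Fin m → Bool) := Finset.sum_le_sum fun u _ => card_coins_eq_mul_pow_le u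
        _ ≤ _ := by
          rw [Finset.sum_const, smul_eq_mul]
          exact Nat.mul_le_mul_right _ (Finset.card_le_univ S)
    have h6 : 0 < 2 ^ m := by positivity
    refine Nat.le_of_mul_le_mul_right (c := 2 ^ m) ?_ h6
    nlinarith [Nat.zero_le (Nat.card (V → Fin m → Bool))]
  have h5 := Finset.sum_le_sum fun u (_ : u ∈ S) => card_headsNeeded_le (m := m) S d hg u
  rw [Finset.sum_add_distrib, ← Finset.mul_sum] at h5
  omega

end Gap

/-! ### Flooding from sources with delayed starts -/

/-- One step of flooding at a vertex. Its state consists of the name of its cluster, if it has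
joined one, and of a flag telling whether it has just joined. A vertex without a cluster founds its
own one when it is time to wake up, and otherwise joins the cluster of which it is told. -/
def floodStep {B d : ℕ} (own : BitVec B) (wake : Bool) (q : Option (BitVec B) × Bool)
    (inbox : Fin d → Option (BitVec B)) : Option (BitVec B) × Bool :=
  if q.1.isSome then (q.1, false)
  else if wake then (some own, true)
  else ((List.finRange d).findSome? inbox, true)

/-- What a vertex tells its neighbors: the name of its cluster if it has just joined it. -/
def announce {B : ℕ} (q : Option (BitVec B) × Bool) : Option (BitVec B) :=
  if q.2 then q.1 else none

section Flood

variable {V : Type u} [Fintype V] {G : SimpleGraph V} [DecidableRel G.Adj]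

/-- The states of the vertices after some number of steps of flooding, where `s v` is the time when
`v` wakes up. -/
def flood (B : ℕ) (N : Network G) (s : V → ℕ) : ℕ → V → Option (BitVec B) × Bool
  | 0 => fun _ => (none, false)
  | i + 1 => fun v => floodStep (BitVec.ofNat B (N.ident v)) (decide (s v = i)) (flood B N s i v)
      fun p : Fin (G.degree v) => announce (flood B N s i ((N.port v).symm p))

variable {B : ℕ} {N : Network G} {s : V → ℕ}

theorem fst_of_announce {q : Option (BitVec B) × Bool} {c : BitVec B} (h : announce q = some c) :
    q.1 = some c := by
  unfold announce at h
  split_ifs at h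
  exact h

theorem flood_succ_of_isSome {i : ℕ} {v : V} (h : (flood B N s i v).1.isSome) :
    flood B N s (i + 1) v = ((flood B N s i v).1, false) := by
  simp [flood, floodStep, h]

theorem flood_fst_mono {i j : ℕ} (hij : i ≤ j) {v : V} {c : BitVec B}
    (h : (flood B N s i v).1 = some c) : (flood B N s j v).1 = some c := by
  induction j, hij using Nat.le_induction with
  | base => exact h
  | succ j _ ih => rw [flood_succ_of_isSome (by simp [ih])]; exact ih

theorem announce_flood_succ {i : ℕ} {v : V} {c : BitVec B}
    (h : announce (flood B N s (i + 1) v) = some c) :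
    (flood B N s i v).1 = none ∧ ((s v = i ∧ c = BitVec.ofNat B (N.ident v)) ∨
      ∃ w, G.Adj w v ∧ announce (flood B N s i w) = some c) := by
  by_cases h1 : (flood B N s i v).1.isSome
  · rw [flood_succ_of_isSome h1] at h
    simp [announce] at h
  · refine ⟨by simpa using h1, ?_⟩
    by_cases h2 : s v = i
    · left
      refine ⟨h2, ?_⟩
      simpa [flood, floodStep, h1, h2, announce, eq_comm] using h
    · right
      simp only [flood, floodStep, h1, h2, decide_false, Bool.false_eq_true, if_false,
        announce, if_true] at h
      obtain ⟨p, _, hp⟩ := List.exists_of_findSome?_eq_some h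
      exact ⟨_, (((N.port v).symm p).property : G.Adj v _).symm, hp⟩

theorem flood_succ_isSome_of_wake (v : V) : (flood B N s (s v + 1) v).1.isSome := by
  by_cases h1 : (flood B N s (s v) v).1.isSome
  · rw [flood_succ_of_isSome h1]; exact h1
  · simp [flood, floodStep, h1]

theorem flood_succ_isSome_of_adj {i : ℕ} {v w : V} (hw : G.Adj w v)
    (h : (announce (flood B N s i w)).isSome) : (flood B N s (i + 1) v).1.isSome := by
  by_cases h1 : (flood B N s i v).1.isSome
  · rw [flood_succ_of_isSome h1]; exact h1
  · by_cases h2 : s v = i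
    · simp [flood, floodStep, h1, h2]
    · simp only [flood, floodStep, h1, h2, decide_false, Bool.false_eq_true, if_false]
      rw [List.findSome?_isSome_iff]
      refine ⟨N.port v ⟨w, hw.symm⟩, List.mem_finRange _, ?_⟩
      simpa using h

theorem announce_flood_succ_of_eq_none {i : ℕ} {v : V} (h : (flood B N s i v).1 = none) :
    announce (flood B N s (i + 1) v) = (flood B N s (i + 1) v).1 := by
  simp only [flood, floodStep, h, Option.isSome_none, Bool.false_eq_true, if_false, announce]
  split_ifs <;> simp_all

theorem exists_announce {i : ℕ} {v : V} {c : BitVec B} (h : (flood B N s i v).1 = some c) :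
    ∃ j < i, announce (flood B N s (j + 1) v) = some c := by
  induction i with
  | zero => simp [flood] at h
  | succ i ih =>
    by_cases h1 : (flood B N s i v).1.isSome
    · rw [flood_succ_of_isSome h1] at h
      obtain ⟨j, hj, h2⟩ := ih h
      exact ⟨j, by omega, h2⟩
    · refine ⟨i, by omega, ?_⟩
      rw [announce_flood_succ_of_eq_none (by simpa using h1), h]

/-- A vertex announces only in the state in which it first has a cluster. Bounding by `isSome`
rather than by 1 makes the induction work: nothing was announced before joining. -/
theorem sum_announce_le (i : ℕ) (v : V) :
    ∑ j ∈ Finset.range (i + 1), (announce (flood B N s j v)).isSome.toNat ≤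
      (flood B N s i v).1.isSome.toNat := by
  induction i with
  | zero => simp [flood, announce]
  | succ i ih =>
    rw [Finset.sum_range_succ]
    by_cases h : (flood B N s i v).1.isSome
    · rw [flood_succ_of_isSome h]
      simpa [announce] using ih
    · have h' : (flood B N s i v).1 = none := by simpa using h
      rw [announce_flood_succ_of_eq_none h']
      rw [h'] at ih
      simp only [Option.isSome_none, Bool.toNat_false] at ih
      omega

theorem sum_announce_le_one (i : ℕ) (v : V) :
    ∑ j ∈ Finset.range i, (announce (flood B N s j v)).isSome.toNat ≤ 1 := by
  refine le_trans ?_ ((sum_announce_le (B := B) (N := N) (s := s) i v).trans (Bool.toNat_le _))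
  exact Finset.sum_le_sum_of_subset (Finset.range_subset_range.2 (Nat.le_succ i))

theorem flood_isSome_of_walk {w x : V} (p : G.Walk w x) :
    (flood B N s (s w + p.length + 1) x).1.isSome := by
  induction hk : p.length generalizing x with
  | zero =>
    obtain rfl := SimpleGraph.Walk.eq_of_length_eq_zero hk
    exact flood_succ_isSome_of_wake w
  | succ k ih =>
    have hp : ¬ p.Nil := by
      intro h
      rw [← SimpleGraph.Walk.length_eq_zero_iff] at h
      omega
    have hy := p.adj_penultimate hp
    have hl : p.dropLast.length = k := by simp [hk]
    obtain ⟨c, hc⟩ := Option.isSome_iff_exists.1 (ih p.dropLast hl)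
    obtain ⟨j, hj, h⟩ := exists_announce hc
    obtain ⟨c', hc'⟩ := Option.isSome_iff_exists.1
      (flood_succ_isSome_of_adj hy (by rw [h]; rfl : (announce (flood B N s (j + 1) _)).isSome))
    rw [flood_fst_mono (by omega) hc']
    rfl

/-- A vertex is joined to the founder of its cluster by a short path inside the cluster. -/
theorem exists_center {T i : ℕ} {v : V} {c : BitVec B} (hi : i < T)
    (h : announce (flood B N s (i + 1) v) = some c) :
    ∃ (hv : v ∈ {x | (flood B N s T x).1 = some c}) (u : {x | (flood B N s T x).1 = some c}),
      c = BitVec.ofNat B (N.ident u) ∧ ∃ p : (G.induce {x | (flood B N s T x).1 = some c}).Walk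
        u ⟨v, hv⟩, s u + p.length = i := by
  have hv : (flood B N s T v).1 = some c := flood_fst_mono (by omega) (fst_of_announce h)
  refine ⟨hv, ?_⟩
  induction i generalizing v with
  | zero =>
    rcases (announce_flood_succ h).2 with ⟨h1, h2⟩ | ⟨w, _, h2⟩
    · exact ⟨⟨v, hv⟩, h2, SimpleGraph.Walk.nil, by simpa using h1⟩
    · simp [flood, announce] at h2
  | succ i ih =>
    rcases (announce_flood_succ h).2 with ⟨h1, h2⟩ | ⟨w, hw, h2⟩
    · exact ⟨⟨v, hv⟩, h2, SimpleGraph.Walk.nil, by simpa using h1⟩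
    · have hw' : (flood B N s T w).1 = some c := flood_fst_mono (by omega) (fst_of_announce h2)
      obtain ⟨u, hu, p, hp⟩ := ih (by omega) h2 hw'
      have hadj : (G.induce {x | (flood B N s T x).1 = some c}).Adj ⟨w, hw'⟩ ⟨v, hv⟩ := hw
      refine ⟨u, hu, p.concat hadj, ?_⟩
      rw [SimpleGraph.Walk.length_concat]
      omega

theorem ofNat_ident_injective (hB : ∀ v, N.ident v < 2 ^ B) :
    Function.Injective fun v => BitVec.ofNat B (N.ident v) := by
  intro v w h
  have h := congrArg BitVec.toNat h
  simp only [BitVec.toNat_ofNat] at h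
  rw [Nat.mod_eq_of_lt (hB v), Nat.mod_eq_of_lt (hB w)] at h
  exact N.ident_injective h

/-- Identifiers survive truncation to `B` bits, so all members of a cluster share one founder, and
each reaches it inside the cluster in fewer than `T` steps. -/
theorem ediam_cluster_le (hB : ∀ v, N.ident v < 2 ^ B) (T : ℕ)
    (c : BitVec B) :
    (G.induce {x | (flood B N s T x).1 = some c}).ediam ≤ (2 * T : ℕ) := by
  rw [SimpleGraph.ediam_le_iff]
  rintro ⟨x, hx⟩ ⟨y, hy⟩
  obtain ⟨i, hi, h⟩ := exists_announce hx
  obtain ⟨j, hj, h'⟩ := exists_announce hy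
  obtain ⟨_, u, hu, p, hp⟩ := exists_center hi h
  obtain ⟨_, w, hw, q, hq⟩ := exists_center hj h'
  obtain rfl : u = w := Subtype.ext (ofNat_ident_injective hB (hu.symm.trans hw))
  refine (SimpleGraph.Walk.edist_le (p.reverse.append q)).trans ?_
  simp only [SimpleGraph.Walk.length_append, SimpleGraph.Walk.length_reverse]
  exact_mod_cast (by omega : p.length + q.length ≤ 2 * T)

/-- If the wave of `u` arrives at `v` more than `2 * t` steps before all other waves, then the
`t`-ball around `v` joins the cluster of `u`. -/
theorem ball_subset_cluster {T t : ℕ} {u v : V} (hu : G.Reachable u v) (hT : ∀ x, s x < T)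
    (h : ∀ w, G.Reachable w v → w ≠ u → s u + G.dist u v + 2 * t < s w + G.dist w v) :
    {x | G.edist v x ≤ t} ⊆ {x | (flood B N s T x).1 = some (BitVec.ofNat B (N.ident u))} := by
  intro x hx
  have hx : G.edist v x ≤ t := hx
  have hvx : G.Reachable v x := by
    rw [← SimpleGraph.edist_ne_top_iff_reachable]
    exact ne_top_of_le_ne_top (ENat.natCast_ne_top t) hx
  obtain ⟨p, hp⟩ := hu.exists_walk_length_eq_dist
  obtain ⟨q, hq⟩ := hvx.exists_walk_length_eq_dist
  have hqt : q.length ≤ t := by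
    rw [hq, SimpleGraph.dist]
    exact ENat.toNat_le_of_le_natCast hx
  obtain ⟨c, hc⟩ := Option.isSome_iff_exists.1
    (flood_succ_isSome_of_wake (B := B) (N := N) (s := s) x)
  have hc := flood_fst_mono (Nat.succ_le_of_lt (hT x)) hc
  obtain ⟨i, hi, ha⟩ := exists_announce hc
  obtain ⟨_, ⟨w, hw'⟩, hw, r, hr⟩ := exists_center hi ha
  -- Some wave reaches `x` no later than the wave of `u` would by way of `v`.
  have hi' : i ≤ s u + (p.append q).length := by
    by_contra! hlt
    obtain ⟨c', hc'⟩ := Option.isSome_iff_exists.1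
      (flood_isSome_of_walk (B := B) (N := N) (s := s) (p.append q))
    have := flood_fst_mono (Nat.succ_le_of_lt hlt) hc'
    rw [(announce_flood_succ ha).1] at this
    simp at this
  rw [SimpleGraph.Walk.length_append] at hi'
  let r' : G.Walk w x := r.map (SimpleGraph.Embedding.induce _).toHom
  have hr' : r'.length = r.length := SimpleGraph.Walk.length_map _ _
  by_cases hwu : w = u
  · subst hwu
    rw [Set.mem_ofPred_eq, hc, hw]
  -- The wave of `w` could continue from `x` to `v`. The detours from `v` to `x` and back cost at
  -- most `t` each, which contradicts the gap `2 * t`.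
  · have h1 := h w (r'.append q.reverse).reachable hwu
    have h2 := SimpleGraph.dist_le (r'.append q.reverse)
    rw [SimpleGraph.Walk.length_append, SimpleGraph.Walk.length_reverse] at h2
    simp only at hr
    omega

end Flood

/-! ### The phases as one CONGEST algorithm -/

/-- The coins that are used in phase `r`. -/
def phaseCoins {R m : ℕ} (x : Fin (R * m) → Bool) (r : Fin R) : Fin m → Bool :=
  fun i => x (finProdFinEquiv (r, i))

/-- The time at which a vertex with coins `x` wakes up in phase `r`. -/
def wakeTime {R m : ℕ} (L : ℕ) (x : Fin (R * m) → Bool) (r : ℕ) : ℕ :=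
  if h : r < R then L * (m - leadingHeads (phaseCoins x ⟨r, h⟩)) else 0

theorem wakeTime_lt {R m : ℕ} (L : ℕ) (x : Fin (R * m) → Bool) (r : ℕ) :
    wakeTime L x r < L * m + 1 := by
  unfold wakeTime
  split_ifs with h
  · exact Nat.lt_succ_of_le (Nat.mul_le_mul_left _ (Nat.sub_le _ _))
  · omega

/-- The state of a vertex: its name, its wake-up times, the number of elapsed rounds, and its state
of flooding in each phase. -/
structure CoverState (B : ℕ) where
  ident : BitVec B
  wake : ℕ → ℕ
  clock : ℕ
  phase : ℕ → Option (BitVec B) × Bool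

/-- `R` successive phases of flooding of `L * m + 1` rounds each, in which every vertex delays its
start by `L` rounds for each of `m` coin flips that is not a leading head. -/
def coverAlgorithm (B R m L : ℕ) : CongestAlgorithm where
  State := CoverState B
  rounds := R * (L * m + 1)
  bandwidth := B
  coins := R * m
  init ident _ x := ⟨BitVec.ofNat B ident, wakeTime L x, 0, fun _ => (none, false)⟩
  send σ _ := announce (σ.phase (σ.clock / (L * m + 1)))
  receive σ _ inbox :=
    { σ with
      clock := σ.clock + 1
      phase := Function.update σ.phase (σ.clock / (L * m + 1))
        (floodStep σ.ident (decide (σ.wake (σ.clock / (L * m + 1)) = σ.clock % (L * m + 1)))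
          (σ.phase (σ.clock / (L * m + 1))) inbox) }
  output σ := (Finset.range R).image fun r => Nat.pair r ((σ.phase r).1.getD 0).toNat

theorem sum_range_mul_le {f : ℕ → ℕ} {T K : ℕ}
    (h : ∀ r, ∑ i ∈ Finset.range T, f (r * T + i) ≤ K) (R : ℕ) :
    ∑ i ∈ Finset.range (R * T), f i ≤ R * K := by
  induction R with
  | zero => simp
  | succ R ih =>
    rw [add_mul, one_mul, Finset.sum_range_add, add_mul, one_mul]
    exact add_le_add ih (h R)

section Correctness

variable {V : Type u} [Fintype V] {G : SimpleGraph V} [DecidableRel G.Adj]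

/-- Truncated subtraction and `min` cover all phases at once: future ones stand at step 0, finished
ones at step `L * m + 1`, and only the current one advances. -/
theorem stateAfter_coverAlgorithm {B R m L : ℕ} (N : Network G) (ω : V → Fin (R * m) → Bool)
    (τ : ℕ) (v : V) :
    (coverAlgorithm B R m L).stateAfter N ω τ v =
      ⟨BitVec.ofNat B (N.ident v), wakeTime L (ω v), τ, fun r =>
        flood B N (fun x => wakeTime L (ω x) r) (min (τ - r * (L * m + 1)) (L * m + 1)) v⟩ := by
  induction τ generalizing v with
  | zero => simp [CongestAlgorithm.stateAfter, coverAlgorithm, flood]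
  | succ τ ih =>
    have hT : 0 < L * m + 1 := Nat.succ_pos _
    have hs : (coverAlgorithm B R m L).stateAfter N ω (τ + 1) v =
      (coverAlgorithm B R m L).receive ((coverAlgorithm B R m L).stateAfter N ω τ v)
        fun p : Fin (G.degree v) => (coverAlgorithm B R m L).send
          ((coverAlgorithm B R m L).stateAfter N ω τ ((N.port v).symm p)) _ := rfl
    rw [hs]
    simp only [ih]
    refine congrArg (CoverState.mk _ _ _) ?_
    change Function.update (fun r => flood B N (fun x => wakeTime L (ω x) r)
        (min (τ - r * (L * m + 1)) (L * m + 1)) v) (τ / (L * m + 1))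
      (floodStep (BitVec.ofNat B (N.ident v))
        (decide (wakeTime L (ω v) (τ / (L * m + 1)) = τ % (L * m + 1)))
        (flood B N (fun x => wakeTime L (ω x) (τ / (L * m + 1)))
          (min (τ - τ / (L * m + 1) * (L * m + 1)) (L * m + 1)) v)
        fun p : Fin (G.degree v) => announce (flood B N
          (fun x => wakeTime L (ω x) (τ / (L * m + 1)))
          (min (τ - τ / (L * m + 1) * (L * m + 1)) (L * m + 1)) ((N.port v).symm p))) = _
    generalize L * m + 1 = T at hT ⊢
    funext r
    have hdm := Nat.div_add_mod' τ T
    have hlt := Nat.mod_lt τ hT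
    rcases lt_trichotomy r (τ / T) with h | rfl | h
    · rw [Function.update_of_ne h.ne]
      have := Nat.mul_le_mul_right T (Nat.succ_le_of_lt h)
      rw [Nat.succ_eq_add_one, add_mul] at this
      rw [min_eq_right (by omega), min_eq_right (by omega)]
    · rw [Function.update_self]
      have h1 : min (τ - τ / T * T) T = τ % T := by omega
      have h2 : min (τ + 1 - τ / T * T) T = τ % T + 1 := by omega
      rw [h1, h2]
      rfl
    · rw [Function.update_of_ne h.ne']
      have := Nat.mul_le_mul_right T (Nat.succ_le_of_lt h)
      rw [Nat.succ_eq_add_one, add_mul] at this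
      have h1 : τ + 1 - r * T = 0 := by omega
      have h2 : τ - r * T = 0 := by omega
      rw [h1, h2]

theorem message_coverAlgorithm {B R m L : ℕ} (N : Network G) (ω : V → Fin (R * m) → Bool)
    (r : ℕ) {i : ℕ} (hi : i < L * m + 1) (v w : V) (h : G.Adj v w) :
    (coverAlgorithm B R m L).message N
        ((coverAlgorithm B R m L).stateAfter N ω (r * (L * m + 1) + i)) v w h =
      announce (flood B N (fun x => wakeTime L (ω x) r) i v) := by
  have h1 : (r * (L * m + 1) + i) / (L * m + 1) = r := by
    rw [add_comm, Nat.add_mul_div_right _ _ (Nat.succ_pos _), Nat.div_eq_of_lt hi, zero_add]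
  have h2 : min (r * (L * m + 1) + i - r * (L * m + 1)) (L * m + 1) = i := by
    rw [Nat.add_sub_cancel_left, min_eq_left hi.le]
  rw [CongestAlgorithm.message, stateAfter_coverAlgorithm]
  simp only [coverAlgorithm, h1, h2]

theorem messagesOnEdge_coverAlgorithm_le {B R m L : ℕ} (N : Network G)
    (ω : V → Fin (R * m) → Bool) (v w : V) (h : G.Adj v w) :
    (coverAlgorithm B R m L).messagesOnEdge N ω v w h ≤ R * 2 := by
  refine sum_range_mul_le (fun r => ?_) R
  rw [Finset.sum_add_distrib]
  refine add_le_add (b := 1) (d := 1) ?_ ?_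
  · refine le_of_eq_of_le (Finset.sum_congr rfl fun i hi => ?_)
      (sum_announce_le_one (B := B) (N := N) (s := fun x => wakeTime L (ω x) r) (L * m + 1) v)
    rw [message_coverAlgorithm N ω r (Finset.mem_range.1 hi)]
    rfl
  · refine le_of_eq_of_le (Finset.sum_congr rfl fun i hi => ?_)
      (sum_announce_le_one (B := B) (N := N) (s := fun x => wakeTime L (ω x) r) (L * m + 1) w)
    rw [message_coverAlgorithm N ω r (Finset.mem_range.1 hi)]
    rfl

theorem output_coverAlgorithm {B R m L : ℕ} (N : Network G) (ω : V → Fin (R * m) → Bool) (v : V) :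
    (coverAlgorithm B R m L).output
        ((coverAlgorithm B R m L).stateAfter N ω (coverAlgorithm B R m L).rounds v) =
      (Finset.range R).image fun r => Nat.pair r
        ((flood B N (fun x => wakeTime L (ω x) r) (L * m + 1) v).1.getD 0).toNat := by
  rw [stateAfter_coverAlgorithm]
  simp only [coverAlgorithm]
  refine Finset.image_congr fun r hr => ?_
  have hr : r < R := by simpa using hr
  have := Nat.mul_le_mul_right (L * m + 1) (Nat.succ_le_of_lt hr)
  rw [Nat.succ_eq_add_one, add_mul, one_mul] at this
  rw [min_eq_right (by omega)]

/-- Every vertex wakes up before its phase ends and so has a cluster by then; the default of `getD`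
in the output is never used. -/
theorem cluster_coverAlgorithm {B R m L : ℕ} (N : Network G) (ω : V → Fin (R * m) → Bool)
    {r : ℕ} (hr : r < R) (c : BitVec B) :
    (coverAlgorithm B R m L).cluster N ω (Nat.pair r c.toNat) =
      {v | (flood B N (fun x => wakeTime L (ω x) r) (L * m + 1) v).1 = some c} := by
  ext v
  obtain ⟨c', hc'⟩ := Option.isSome_iff_exists.1
    (flood_succ_isSome_of_wake (B := B) (N := N) (s := fun x => wakeTime L (ω x) r) v)
  have hc' := flood_fst_mono (Nat.succ_le_of_lt (wakeTime_lt L (ω v) r)) hc'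
  change Nat.pair r c.toNat ∈ (coverAlgorithm B R m L).output _ ↔ _
  rw [output_coverAlgorithm, Finset.mem_image, Set.mem_ofPred_eq]
  constructor
  · rintro ⟨r', _, h⟩
    obtain ⟨rfl, h'⟩ := Nat.pair_eq_pair.1 h
    rw [hc'] at h' ⊢
    exact congrArg some (BitVec.eq_of_toNat_eq h')
  · intro h
    exact ⟨r, Finset.mem_range.2 hr, by rw [h]; rfl⟩

/-- Since heads never exceed `m`, the wake-up time `L * (m - heads)` involves no truncated
subtraction, and leading by heads means arriving first by more than `2 * t`. Each phase contributes
one label per vertex, so the overlap is at most `R`. -/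
theorem isNeighborhoodCover_coverAlgorithm {B R m L t : ℕ} (N : Network G)
    (hB : ∀ v, N.ident v < 2 ^ B) (ω : V → Fin (R * m) → Bool) {d q : ℝ}
    (hd : ((2 * (L * m + 1) : ℕ) : ℝ) ≤ d) (hq : (R : ℝ) ≤ q) (S : V → Finset V)
    (hS : ∀ v w, w ∈ S v ↔ G.Reachable w v)
    (h : ∀ v, ∃ r : Fin R, ∃ u ∈ S v, Leads (S v) (fun w => G.dist w v) L (2 * t)
      (fun w => phaseCoins (ω w) r) u) :
    IsNeighborhoodCover G t d q ((coverAlgorithm B R m L).cluster N ω) where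
  ball_subset v := by
    obtain ⟨r, u, hu, hlead⟩ := h v
    refine ⟨Nat.pair r (BitVec.ofNat B (N.ident u)).toNat, ?_⟩
    rw [cluster_coverAlgorithm N ω r.2]
    refine ball_subset_cluster ((hS v u).1 hu) (fun x => wakeTime_lt L (ω x) r) fun w hw hwu => ?_
    have h1 := hlead w ((hS v w).2 hw) hwu
    have h2 := Nat.mul_le_mul_left L (leadingHeads_le (phaseCoins (ω w) r))
    have h3 := Nat.mul_le_mul_left L (leadingHeads_le (phaseCoins (ω u) r))
    beta_reduce at h1
    simp only [wakeTime, r.2, dite_true, Nat.mul_sub, Fin.eta]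
    omega
  diam_le l := by
    have key : (G.induce ((coverAlgorithm B R m L).cluster N ω l)).ediam ≤
        (2 * (L * m + 1) : ℕ) := by
      rcases Set.eq_empty_or_nonempty ((coverAlgorithm B R m L).cluster N ω l) with h0 | ⟨v, hv⟩
      · rw [SimpleGraph.ediam_le_iff]
        rintro ⟨x, hx⟩
        rw [h0] at hx
        exact hx.elim
      · change l ∈ (coverAlgorithm B R m L).output _ at hv
        rw [output_coverAlgorithm, Finset.mem_image] at hv
        obtain ⟨r, hr, rfl⟩ := hv
        rw [cluster_coverAlgorithm N ω (Finset.mem_range.1 hr)]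
        exact ediam_cluster_le hB _ _
    refine ⟨ne_top_of_le_ne_top (ENat.natCast_ne_top _) key, le_trans ?_ hd⟩
    exact_mod_cast ENat.toNat_le_of_le_natCast key
  overlap_le v := by
    have h1 : {i | v ∈ (coverAlgorithm B R m L).cluster N ω i} =
        ((coverAlgorithm B R m L).output
          ((coverAlgorithm B R m L).stateAfter N ω (coverAlgorithm B R m L).rounds v)) := rfl
    rw [h1]
    refine ⟨Finset.finite_toSet _, le_trans ?_ hq⟩
    rw [Set.ncard_coe_finset, output_coverAlgorithm]
    exact_mod_cast Finset.card_image_le.trans_eq (Finset.card_range R)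

end Correctness

/-! ### Amplification over independent phases -/

/-- Coins split by phase, an injection into a product: independence in counting form. -/
theorem card_forall_phase_le {V : Type u} [Finite V] {R m : ℕ} (Q : (V → Fin m → Bool) → Prop) :
    Nat.card {ω : V → Fin (R * m) → Bool // ∀ r, Q fun v => phaseCoins (ω v) r} ≤
      Nat.card {ω : V → Fin m → Bool // Q ω} ^ R := by
  have h : Nat.card (Fin R → {ω : V → Fin m → Bool // Q ω}) =
      Nat.card {ω : V → Fin m → Bool // Q ω} ^ R := by
    rw [Nat.card_fun, Nat.card_eq_fintype_card (α := Fin R), Fintype.card_fin]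
  rw [← h]
  refine Nat.card_le_card_of_injective (fun ω r => ⟨fun v => phaseCoins (ω.1 v) r, ω.2 r⟩) ?_
  rintro ⟨ω, _⟩ ⟨ω', _⟩ h
  apply Subtype.ext
  funext v j
  obtain ⟨⟨r, i⟩, rfl⟩ := finProdFinEquiv.surjective j
  exact congrFun (congrFun (congrArg Subtype.val (congrFun h r)) v) i

theorem card_coins_mul {V : Type u} [Fintype V] (R m : ℕ) :
    Nat.card (V → Fin (R * m) → Bool) = Nat.card (V → Fin m → Bool) ^ R := by
  simp only [Nat.card_fun, Nat.card_eq_fintype_card, Fintype.card_fun, Fintype.card_fin,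
    Fintype.card_bool, ← pow_mul]
  ring

/-- After `3 * (c + 1) * l` phases, it is unlikely that a vertex has no leader in any phase. -/
theorem card_exists_forall_not_leads_le {V : Type u} [Fintype V] {m L g l c : ℕ}
    (S : V → Finset V) (hS : ∀ v, (S v).Nonempty) (d : V → V → ℕ) (hg : g < L)
    (hm : 2 * Fintype.card V ≤ 2 ^ m) (hl : Fintype.card V ≤ 2 ^ l) (hV : 0 < Fintype.card V) :
    Fintype.card V ^ c * Nat.card {ω : V → Fin (3 * ((c + 1) * l) * m) → Bool // ∃ v, ∀ r,
        ¬ ∃ u ∈ S v, Leads (S v) (fun w => d w v) L g (fun w => phaseCoins (ω w) r) u} ≤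
      Nat.card (V → Fin (3 * ((c + 1) * l) * m) → Bool) := by
  classical
  set ρ := (c + 1) * l with hρ
  set n := Fintype.card V with hn
  let Q (v : V) (ω : V → Fin m → Bool) : Prop :=
    ¬ ∃ u ∈ S v, Leads (S v) (fun w => d w v) L g ω u
  have h1 : ∀ v, 4 ^ (3 * ρ) * Nat.card {ω : V → Fin (3 * ρ * m) → Bool //
      ∀ r, Q v fun w => phaseCoins (ω w) r} ≤
        3 ^ (3 * ρ) * Nat.card (V → Fin (3 * ρ * m) → Bool) := by
    intro v
    calc _ ≤ 4 ^ (3 * ρ) * Nat.card {ω : V → Fin m → Bool // Q v ω} ^ (3 * ρ) :=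
          Nat.mul_le_mul_left _ (card_forall_phase_le (Q v))
      _ = (4 * Nat.card {ω : V → Fin m → Bool // Q v ω}) ^ (3 * ρ) := (mul_pow _ _ _).symm
      _ ≤ (3 * Nat.card (V → Fin m → Bool)) ^ (3 * ρ) :=
          Nat.pow_le_pow_left (card_not_exists_leads_le (hS v) _ hg hm) _
      _ = _ := by rw [mul_pow, card_coins_mul]
  have h2 : Nat.card {ω : V → Fin (3 * ρ * m) → Bool //
      ∃ v, ∀ r, Q v fun w => phaseCoins (ω w) r} ≤
      ∑ v, Nat.card {ω : V → Fin (3 * ρ * m) → Bool //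
        ∀ r, Q v fun w => phaseCoins (ω w) r} := by
    simp only [Nat.card_eq_fintype_card, Fintype.card_subtype]
    refine le_trans (Finset.card_le_card fun ω hω => ?_) Finset.card_biUnion_le
    simpa using hω
  set F := Nat.card {ω : V → Fin (3 * ρ * m) → Bool // ∃ v, ∀ r, Q v fun w => phaseCoins (ω w) r}
  set W := Nat.card (V → Fin (3 * ρ * m) → Bool)
  have h3 : 4 ^ (3 * ρ) * F ≤ n * (3 ^ (3 * ρ) * W) := by
    refine (Nat.mul_le_mul_left _ h2).trans ?_
    rw [Finset.mul_sum]
    refine (Finset.sum_le_sum fun v _ => h1 v).trans_eq ?_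
    rw [Finset.sum_const, smul_eq_mul, Finset.card_univ]
  -- Three phases at least halve the failure probability, as `2 * 27 ≤ 64`; hence the factor 3 in
  -- the number of phases. One of the `c + 1` powers of `n` pays for the union bound.
  have h4 : n ^ (c + 1) * 3 ^ (3 * ρ) ≤ 4 ^ (3 * ρ) := by
    calc _ ≤ (2 ^ l) ^ (c + 1) * 3 ^ (3 * ρ) :=
          Nat.mul_le_mul_right _ (Nat.pow_le_pow_left hl _)
      _ = (2 * 3 ^ 3) ^ ρ := by rw [← pow_mul, mul_comm l, ← hρ, mul_pow, ← pow_mul 3]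
      _ ≤ (4 ^ 3) ^ ρ := Nat.pow_le_pow_left (by norm_num) _
      _ = _ := by rw [← pow_mul]
  refine Nat.le_of_mul_le_mul_left (c := n * 3 ^ (3 * ρ)) ?_ (by positivity)
  calc _ = n ^ (c + 1) * 3 ^ (3 * ρ) * F := by ring
    _ ≤ 4 ^ (3 * ρ) * F := Nat.mul_le_mul_right _ h4
    _ ≤ n * (3 ^ (3 * ρ) * W) := h3
    _ = _ := by ring

theorem one_sub_le_uniformOfFintype_real {Ω : Type*} [Fintype Ω] [Nonempty Ω] [MeasurableSpace Ω]
    [DiscreteMeasurableSpace Ω] {P : Ω → Prop} {K : ℕ} (hK : 0 < K)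
    (h : K * Nat.card {ω // ¬ P ω} ≤ Nat.card Ω) :
    1 - 1 / (K : ℝ) ≤ (PMF.uniformOfFintype Ω).toMeasure.real {ω | P ω} := by
  classical
  rw [MeasureTheory.measureReal_def, PMF.toMeasure_uniformOfFintype_apply _ .of_discrete]
  have h1 := Fintype.card_subtype_compl P
  have h2 := Fintype.card_subtype_le P
  have h3 : (Fintype.card {ω | P ω} : ℝ) = Fintype.card Ω - Fintype.card {ω // ¬ P ω} := by
    rw [h1, Nat.cast_sub h2, sub_sub_cancel]
    rfl
  have hpos : (0 : ℝ) < Fintype.card Ω := by exact_mod_cast Fintype.card_pos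
  have hK' : (0 : ℝ) < K := by exact_mod_cast hK
  rw [ENNReal.toReal_div, ENNReal.toReal_natCast, ENNReal.toReal_natCast, h3, sub_div,
    div_self hpos.ne']
  refine sub_le_sub_left ?_ 1
  rw [div_le_div_iff₀ hpos hK', one_mul, mul_comm]
  simp only [Nat.card_eq_fintype_card] at h
  exact_mod_cast h

/-! ### Choice of parameters -/

theorem mainTheorem9 :
    -- identifiers have at most `a * log n` bits, messages at most `b * log n` bits
    ∀ a : ℕ, ∃ b e : ℕ, ∀ c : ℕ, ∃ C : ℝ, ∃ A : ℕ → ℕ → CongestAlgorithm,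
      ∀ n t : ℕ, 2 ≤ n → 1 ≤ t → ∀ k : ℝ, k = 2 * Real.logb 2 n →
        ((A n t).bandwidth : ℝ) ≤ b * Real.logb 2 n ∧
        ((A n t).rounds : ℝ) ≤ C * (k * t * Real.logb 2 n) ∧
        ∀ (V : Type u) [Fintype V] [DecidableEq V] (G : SimpleGraph V) [DecidableRel G.Adj]
          (N : Network G), Fintype.card V = n → (∀ v, N.ident v < n ^ a) →
          (∀ (ω : V → Fin (A n t).coins → Bool) (v w : V) (h : G.Adj v w),
            ((A n t).messagesOnEdge N ω v w h : ℝ) ≤ C * Real.logb 2 n ^ e) ∧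
          1 - 1 / (n : ℝ) ^ c ≤
            (PMF.uniformOfFintype (V → Fin (A n t).coins → Bool)).toMeasure.real
              {ω | IsNeighborhoodCover G t (C * (t * k * Real.logb 2 n)) (C * Real.logb 2 n)
                ((A n t).cluster N ω)} := by
  intro a
  -- The extra 1 in `m` gives `2 * n ≤ 2 ^ m`, and `L = 2 * t + 1` exceeds the gap. As `clog 2 n ≤ 2
  -- * l`, there are at most `6 * (c + 1) * l` phases of at most `10 * t * l` rounds, whence 60.
  refine ⟨2 * a, 1, fun c => ⟨60 * (c + 1), fun n t => coverAlgorithm (a * Nat.clog 2 n)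
    (3 * ((c + 1) * Nat.clog 2 n)) (Nat.clog 2 n + 1) (2 * t + 1), ?_⟩⟩
  rintro n t hn ht k rfl
  set l := Real.logb 2 n with hl
  have hl1 : 1 ≤ l := by
    rw [hl, Real.le_logb_iff_rpow_le (by norm_num) (by positivity)]
    simpa using (by exact_mod_cast hn : (2 : ℝ) ≤ n)
  have hg : (Nat.clog 2 n : ℝ) ≤ 2 * l := by
    have h1 : ⌈l⌉₊ = Nat.clog 2 n := Real.natCeil_logb_natCast 2 n
    have h2 := Nat.ceil_lt_add_one (zero_le_one.trans hl1)
    rw [h1] at h2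
    linarith
  have hclog : n ≤ 2 ^ Nat.clog 2 n := Nat.le_pow_clog (by norm_num) n
  have ht' : (1 : ℝ) ≤ t := by exact_mod_cast ht
  have hc : (0 : ℝ) ≤ c := Nat.cast_nonneg c
  have hR : ((3 * ((c + 1) * Nat.clog 2 n) : ℕ) : ℝ) ≤ 6 * (c + 1) * l := by
    push_cast
    nlinarith
  have hT : (((2 * t + 1) * (Nat.clog 2 n + 1) + 1 : ℕ) : ℝ) ≤ 10 * (t * l) := by
    push_cast
    have h1 : (1 : ℝ) ≤ t * l := one_le_mul_of_one_le_of_one_le ht' hl1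
    have h2 : (2 * t + 1 : ℝ) * (Nat.clog 2 n + 1) ≤ (3 * t) * (3 * l) :=
      mul_le_mul (by linarith) (by linarith) (by positivity) (by positivity)
    linarith
  have hcl : 0 ≤ (c + 1) * l := by positivity
  refine ⟨?_, ?_, ?_⟩
  · change ((a * Nat.clog 2 n : ℕ) : ℝ) ≤ ((2 * a : ℕ) : ℝ) * l
    push_cast
    nlinarith [Nat.cast_nonneg (α := ℝ) a]
  · change ((3 * ((c + 1) * Nat.clog 2 n) * ((2 * t + 1) * (Nat.clog 2 n + 1) + 1) : ℕ) : ℝ) ≤ _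
    rw [Nat.cast_mul]
    refine (mul_le_mul hR hT (Nat.cast_nonneg _) (by positivity)).trans ?_
    have : 0 ≤ (c + 1) * l * (t * l) := by positivity
    linarith
  · intro V _ _ G _ N hV hid
    classical
    subst hV
    refine ⟨fun ω v w h => ?_, ?_⟩
    · have h1 : ((coverAlgorithm _ _ _ _).messagesOnEdge N ω v w h : ℝ) ≤ _ :=
        Nat.cast_le.2 (messagesOnEdge_coverAlgorithm_le N ω v w h)
      refine h1.trans ?_
      rw [Nat.cast_mul, pow_one]
      push_cast at hR ⊢
      linarith
    · rw [← Nat.cast_pow]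
      -- Only the component of `v` competes: `dist` is 0 between different components.
      let S (v : V) : Finset V := Finset.univ.filter fun w => G.Reachable w v
      have hS : ∀ v w, w ∈ S v ↔ G.Reachable w v := fun v w => by simp [S]
      refine one_sub_le_uniformOfFintype_real (by positivity) ?_
      refine le_trans (Nat.mul_le_mul_left _ ?_) (card_exists_forall_not_leads_le (g := 2 * t) S
        (fun v => ⟨v, (hS v v).2 (SimpleGraph.Reachable.refl v)⟩) (fun w v => G.dist w v)
        (Nat.lt_succ_self (2 * t)) (m := Nat.clog 2 (Fintype.card V) + 1) ?_ hclog (by omega))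
      · refine Nat.card_le_card_of_injective (fun ω => ⟨ω.1, ?_⟩) fun ω ω' h =>
          Subtype.ext (congrArg (fun z => z.1) h)
        -- A failed cover requires a vertex without a leader in every phase.
        by_contra! hlead
        refine ω.2 (isNeighborhoodCover_coverAlgorithm N (fun v => (hid v).trans_le ?_) ω.1
          ?_ ?_ S hS hlead)
        · rw [mul_comm, pow_mul]
          exact Nat.pow_le_pow_left hclog a
        · rw [Nat.cast_mul]
          have h1 : (t : ℝ) * l ≤ (c + 1) * (t * (l * l)) := by
            have : (t : ℝ) * l ≤ t * (l * l) := by nlinarith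
            nlinarith [mul_nonneg hc (by positivity : (0 : ℝ) ≤ t * (l * l))]
          push_cast at hT ⊢
          have h2 : 0 ≤ (t : ℝ) * l := by positivity
          linarith
        · linarith
      · rw [pow_succ]
        omega
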